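/- A ReLU network on $\mathbb{R}^d$ is a fully connected feed-forward network: each neuron of a hidden layer computes $\max\{0,\cdot\}$ of an affine function (with arbitrary real weights and bias) of the outputs of the previous layer (of the input, for the first hidden layer), and a single output neuron computes an affine function of the outputs of the last hidden layer. Its depth is the number of hidden layers plus one, and its width is the number of neurons in its largest hidden layer. **Theorem.** Let $d,k$ be positive integers with $3\le k\le\log_2(\log_2 d)$, and let $\mathcal{N}$ be a depth-$k$ ReLU network such that $\mathcal{N}(\mathbf{x})=\max\{x_1,\dots,x_d\}$ for all $\mathbf{x}\in[0,1]^d$. Then $\mathcal{N}$ has width at least $$0.1\, d^{\,1+\frac{1}{2^{k-2}-1}}.$$ -/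

import Mathlib

/-- Fully connected feed-forward ReLU networks computing a function `ℝⁿ → ℝ`.
`output w b` is the single output neuron, an affine function of its `n` inputs.
`hidden W b N` is a hidden layer of `m` neurons on `n` inputs, with arbitrary real weights `W` and
biases `b`, followed by the ReLU, whose outputs are fed to the rest `N` of the network. -/
inductive ReLUNetwork : ℕ → Type
  | output {n : ℕ} (w : Fin n → ℝ) (b : ℝ) : ReLUNetwork n
  | hidden {n m : ℕ} (W : Matrix (Fin m) (Fin n) ℝ) (b : Fin m → ℝ) (N : ReLUNetwork m) :
      ReLUNetwork n

namespace ReLUNetwork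

/-- The function computed by the network. -/
noncomputable def eval : {n : ℕ} → ReLUNetwork n → (Fin n → ℝ) → ℝ
  | _, output w b, x => (∑ i, w i * x i) + b
  | _, hidden W b N, x => N.eval fun j => max 0 ((∑ i, W j i * x i) + b j)

/-- The depth: the number of hidden layers plus one. -/
def depth : {n : ℕ} → ReLUNetwork n → ℕ
  | _, output _ _ => 1
  | _, hidden _ _ N => N.depth + 1

/-- The width: the number of neurons in the largest hidden layer (`0` without hidden layers). -/
def width : {n : ℕ} → ReLUNetwork n → ℕ
  | _, output _ _ => 0
  | _, hidden (m := m) _ _ N => max m N.width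

end ReLUNetwork

/-- The maximum `max {x₁, …, x_d}` of the coordinates of `x ∈ ℝᵈ` (for `d ≥ 1`). -/
noncomputable def maxCoord {d : ℕ} (x : Fin d → ℝ) : ℝ := ⨆ i, x i

theorem isGreatest_maxCoord {d : ℕ} (hd : 0 < d) (x : Fin d → ℝ) :
    IsGreatest (Set.range x) (maxCoord x) := by
  have : Nonempty (Fin d) := ⟨⟨0, hd⟩⟩
  refine ⟨?_, ?_⟩
  · obtain ⟨i, hi⟩ := exists_eq_ciSup_of_finite (f := x)
    exact ⟨i, hi⟩
  · rintro _ ⟨i, rfl⟩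
    exact le_ciSup (Set.finite_range x).bddAbove i

/-! Hidden layers are peeled off one at a time, keeping a network that computes the maximum near
some constant vector. Each first-layer neuron whose weights have support of size at least two
contributes one edge on the coordinates; by Turán, `D` coordinates and `m` neurons leave an
independent set `I` with `|I| ≥ D² / (2m + D)`. At a generic point where the coordinates in `I` are
equal and exceed the others, no nonzero neuron is at its kink, so the layer is locally affine and is
absorbed by the next one (`exists_restrict`). Freezing the other coordinates leaves the maximum over
`I`.

Each removal thus at worst squares the ratio `D / A`, for a fixed `A ≥ 2 * width + d`. A single
hidden layer handles at most two inputs, so `A (d/A)^(2^(k-2)) ≤ 2`, which fails when the width is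
too small. -/

open Filter Topology

/-! ### Turán bound and the graph of neuron supports -/

/-- A quantitative form of Turán's theorem for independent sets. -/
theorem SimpleGraph.exists_isIndepSet_sq_le {V : Type*} [Fintype V] [DecidableEq V]
    (G : SimpleGraph V) [DecidableRel G.Adj] :
    ∃ s : Finset V, G.IsIndepSet s ∧
      Fintype.card V ^ 2 ≤ (2 * G.edgeFinset.card + Fintype.card V) * s.card := by
  obtain ⟨s, hs⟩ := G.exists_isNIndepSet_indepNum
  refine ⟨s, hs.isIndepSet, ?_⟩
  rw [hs.card_eq]
  set r := G.indepNum with hr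
  set n := Fintype.card V with hn
  have hfree : Gᶜ.CliqueFree (r + 1) := by
    intro t ht
    have h := ht.isClique.card_le_cliqueNum
    rw [ht.card_eq, SimpleGraph.cliqueNum_compl] at h
    omega
  have hT := hfree.card_edgeFinset_le
  simp only [← hn] at hT
  have hsum : G.edgeFinset.card + Gᶜ.edgeFinset.card = n.choose 2 := by
    rw [← SimpleGraph.card_edgeFinset_top_eq_card_choose_two, ← Finset.card_union_of_disjoint
      (SimpleGraph.disjoint_edgeFinset.2 disjoint_compl_right), ← SimpleGraph.edgeFinset_sup]
    congr 1
    ext e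
    induction e with | h a b
    have := G.ne_of_adj (a := a) (b := b)
    simp
    tauto
  rcases Nat.eq_zero_or_pos r with h0 | h0
  · have : n = 0 := by
      by_contra hne
      have : 0 < Fintype.card V := Nat.pos_of_ne_zero hne
      obtain ⟨v⟩ := Fintype.card_pos_iff.1 this
      have h := SimpleGraph.IsIndepSet.card_le_indepNum (G := G) (t := {v}) (by simp [SimpleGraph.IsIndepSet])
      simp at h
      omega
    simp [this]
  have hmod : n % r ≤ n := Nat.mod_le _ _
  have hmr : n % r < r := Nat.mod_lt _ h0
  set q := n % r
  have hdiv : 2 * r * ((n ^ 2 - q ^ 2) * (r - 1) / (2 * r)) ≤ (n ^ 2 - q ^ 2) * (r - 1) :=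
    Nat.mul_div_le _ _
  set X := (n ^ 2 - q ^ 2) * (r - 1) / (2 * r)
  have hsq : q ^ 2 ≤ n ^ 2 := Nat.pow_le_pow_left hmod 2
  have h1 : (1:ℕ) ≤ r := h0
  have hcn : ∀ a : ℕ, 2 * ((a.choose 2 : ℕ) : ℤ) = a * (a - 1) := by
    intro a
    have := Nat.choose_two_right a
    have h2 := Nat.div_mul_cancel (Nat.even_mul_pred_self a).two_dvd
    rw [← this] at h2
    rcases a with _ | a
    · simp
    · simp only [Nat.add_sub_cancel] at h2
      push_cast
      have : (((a+1).choose 2 * 2 : ℕ) : ℤ) = ((a+1)*a : ℕ) := by exact_mod_cast h2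
      push_cast at this
      linarith
  have hcn1 := hcn n
  have hcq := hcn q
  zify [hsq, h1] at hdiv hT hsum hmr ⊢
  -- After clearing denominators, the Turán bound beats the claim by exactly `q * (r - q)`.
  nlinarith [mul_nonneg (Int.natCast_nonneg q) (sub_nonneg.2 hmr.le)]

/-- Given `m` vectors, some large set of coordinates contains none of their supports that has at
least two elements. -/
theorem exists_finset_support_subsingleton {n m : ℕ} (W : Matrix (Fin m) (Fin n) ℝ) :
    ∃ I : Finset (Fin n), n ^ 2 ≤ (2 * m + n) * I.card ∧
      ∀ j, (∀ i ∉ I, W j i = 0) → ∀ a b, W j a ≠ 0 → W j b ≠ 0 → a = b := by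
  classical
  have hex : ∀ j, ∃ e : Sym2 (Fin n) ⊕ Unit, (∀ a b, W j a ≠ 0 → W j b ≠ 0 → a = b) ∨
      ∃ a b, a ≠ b ∧ W j a ≠ 0 ∧ W j b ≠ 0 ∧ e = Sum.inl s(a, b) := by
    intro j
    by_cases h : ∀ a b, W j a ≠ 0 → W j b ≠ 0 → a = b
    · exact ⟨Sum.inr (), Or.inl h⟩
    · push Not at h
      obtain ⟨a, b, ha, hb, hab⟩ := h
      exact ⟨Sum.inl s(a, b), Or.inr ⟨a, b, hab, ha, hb, rfl⟩⟩
  choose e he using hex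
  let S : Finset (Sym2 (Fin n)) := (Finset.univ.image e).toLeft
  let G : SimpleGraph (Fin n) := SimpleGraph.fromEdgeSet (S : Set (Sym2 (Fin n)))
  obtain ⟨I, hI, hcard⟩ := G.exists_isIndepSet_sq_le
  have hS : G.edgeFinset.card ≤ m := by
    calc G.edgeFinset.card ≤ S.card := by
          refine Finset.card_le_card fun x hx => ?_
          simp only [G, SimpleGraph.mem_edgeFinset, SimpleGraph.edgeSet_fromEdgeSet] at hx
          exact hx.1
      _ ≤ (Finset.univ.image e).card := Finset.card_toLeft_le
      _ ≤ m := Finset.card_image_le.trans (by simp)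
  refine ⟨I, ?_, ?_⟩
  · rw [Fintype.card_fin] at hcard
    refine hcard.trans (Nat.mul_le_mul_right _ (Nat.add_le_add_right (Nat.mul_le_mul_left 2 ?_) _))
    convert hS
  · intro j hj
    rcases he j with h | ⟨a, b, hab, ha, hb, hej⟩
    · exact h
    · exfalso
      have haI : a ∈ I := by by_contra h; exact ha (hj a h)
      have hbI : b ∈ I := by by_contra h; exact hb (hj b h)
      refine hI haI hbI hab ?_
      simp only [G, SimpleGraph.fromEdgeSet_adj]
      exact ⟨by simpa [S] using ⟨j, hej⟩, hab⟩

/-! ### Generic points and removal of the first layer -/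

/-- A curve starting at the constant vector `t`: along it, the coordinates in `I` stay equal and
above the others, which move away from `t` at pairwise different orders. -/
noncomputable def genericCurve {n : ℕ} (I : Finset (Fin n)) (t s : ℝ) (i : Fin n) : ℝ :=
  if i ∈ I then t + s else t - s ^ (i.val + 2)

/-- An affine form whose support is not a set of at least two elements of `I` is either zero or
eventually nonzero along the curve. -/
theorem affine_genericCurve_ne_zero {n : ℕ} (I : Finset (Fin n)) (t : ℝ) (w : Fin n → ℝ) (b : ℝ)
    (hw : (∀ i ∉ I, w i = 0) → ∀ a c, w a ≠ 0 → w c ≠ 0 → a = c) :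
    (w = 0 ∧ b = 0) ∨ ∀ᶠ s in 𝓝[>] (0 : ℝ), (∑ i, w i * genericCurve I t s i) + b ≠ 0 := by
  let P : Polynomial ℝ := (∑ i, Polynomial.C (w i) *
    (Polynomial.C t + if i ∈ I then Polynomial.X else -Polynomial.X ^ (i.val + 2))) + Polynomial.C b
  have hP : ∀ s, P.eval s = (∑ i, w i * genericCurve I t s i) + b := by
    intro s
    simp only [P, Polynomial.eval_add, Polynomial.eval_finsetSum, Polynomial.eval_mul,
      Polynomial.eval_C, genericCurve]
    congr 1
    refine Finset.sum_congr rfl fun i _ => ?_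
    split_ifs <;> simp [sub_eq_add_neg]
  by_cases h0 : P = 0
  · left
    -- The exponents `i + 2` are distinct and at least 2, so each isolates one outside weight;
    -- degree 1 sees only the sum over `I`.
    have hout : ∀ i ∉ I, w i = 0 := by
      intro i hi
      have h := congrArg (fun Q => Polynomial.coeff Q (i.val + 2)) h0
      simp only [P, Polynomial.coeff_add, Polynomial.finsetSum_coeff, Polynomial.coeff_C_mul,
        Polynomial.coeff_C, Polynomial.coeff_zero] at h
      rw [Finset.sum_eq_single i] at h
      · simpa [hi] using h
      · intro k _ hk
        have : i.val ≠ k.val := fun h => hk (Fin.ext h.symm)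
        by_cases hkI : k ∈ I <;> simp [hkI, Polynomial.coeff_X, Polynomial.coeff_X_pow, this]
      · simp
    have hin : ∑ i, w i = 0 := by
      have h := congrArg (fun Q => Polynomial.coeff Q 1) h0
      simp only [P, Polynomial.coeff_add, Polynomial.finsetSum_coeff, Polynomial.coeff_C_mul,
        Polynomial.coeff_C, Polynomial.coeff_zero] at h
      rw [← h]
      simp only [one_ne_zero, if_false, add_zero, zero_add]
      refine Finset.sum_congr rfl fun i _ => ?_
      by_cases hi : i ∈ I
      · simp [hi]
      · simp [hi, hout i hi]
    have hw0 : w = 0 := by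
      by_contra hne
      obtain ⟨a, ha⟩ := Function.ne_iff.1 hne
      refine ha ?_
      rw [Pi.zero_apply, ← hin, Finset.sum_eq_single a]
      · intro c _ hc
        by_contra hcw
        exact hc (hw hout c a hcw ha)
      · simp
    refine ⟨hw0, ?_⟩
    have := hP 0
    simpa [h0, hw0] using this.symm
  · right
    have hfin : ({s | P.IsRoot s} : Set ℝ).Finite := Polynomial.finite_setOfPred_isRoot h0
    have h1 : ∀ᶠ s in 𝓝[≠] (0:ℝ), ¬ P.IsRoot s := by
      have := hfin.subset (Set.sdiff_subset (t := {0}))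
      have h2 := this.isClosed.isOpen_compl.mem_nhds (x := (0:ℝ)) (by simp)
      filter_upwards [nhdsWithin_le_nhds h2, self_mem_nhdsWithin] with s hs hs0 hr
      exact hs ⟨hr, hs0⟩
    have h2 := h1.filter_mono (nhdsWithin_mono (0:ℝ) (s := Set.Ioi 0) fun x hx => ne_of_gt hx)
    filter_upwards [h2] with s hs
    rw [← hP]
    exact hs

namespace ReLUNetwork

/-- Precomposing with an affine map changes neither depth nor width. -/
theorem exists_eval_affine {n m : ℕ} (N : ReLUNetwork m) (A : Matrix (Fin m) (Fin n) ℝ)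
    (c : Fin m → ℝ) :
    ∃ N' : ReLUNetwork n, N'.depth = N.depth ∧ N'.width = N.width ∧
      ∀ y, N'.eval y = N.eval fun j => (∑ i, A j i * y i) + c j := by
  have key : ∀ (w : Fin m → ℝ) (b : ℝ) (y : Fin n → ℝ),
      (∑ i, (∑ j, w j * A j i) * y i) + ((∑ j, w j * c j) + b) =
        (∑ j, w j * ((∑ i, A j i * y i) + c j)) + b := by
    intro w b y
    simp only [mul_add, Finset.sum_add_distrib, Finset.mul_sum, Finset.sum_mul]
    rw [Finset.sum_comm]
    simp only [mul_assoc, add_assoc]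
  cases N with
  | output w b =>
    exact ⟨output (fun i => ∑ j, w j * A j i) ((∑ j, w j * c j) + b), rfl, rfl, key w b⟩
  | hidden W b N =>
    refine ⟨hidden (fun l i => ∑ j, W l j * A j i) (fun l => (∑ j, W l j * c j) + b l) N,
      rfl, rfl, fun y => ?_⟩
    simp only [eval]
    congr 1
    funext l
    rw [key]

end ReLUNetwork

theorem maxCoord_eq {n : ℕ} {x : Fin n → ℝ} {a : ℝ} (i : Fin n) (hi : x i = a)
    (h : ∀ j, x j ≤ a) : maxCoord x = a := by
  have : Nonempty (Fin n) := ⟨i⟩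
  exact le_antisymm (ciSup_le h) (hi ▸ le_ciSup (Set.finite_range x).bddAbove i)


theorem eventually_max_zero_eq {X : Type*} [TopologicalSpace X] {g : X → ℝ} {p : X}
    (hg : Continuous g) (h : (∀ x, g x = 0) ∨ g p ≠ 0) :
    ∃ a : ℝ, ∀ᶠ x in 𝓝 p, max 0 (g x) = a * g x := by
  rcases h with h | h
  · exact ⟨0, by simp [h]⟩
  rcases lt_or_gt_of_ne h with h | h
  · refine ⟨0, ?_⟩
    filter_upwards [hg.continuousAt.eventually_lt_const h] with x hx
    rw [max_eq_left hx.le, zero_mul]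
  · refine ⟨1, ?_⟩
    filter_upwards [hg.continuousAt.eventually_const_lt h] with x hx
    rw [max_eq_right hx.le, one_mul]

theorem eventually_genericCurve {n : ℕ} (I : Finset (Fin n)) (t : ℝ) {p : (Fin n → ℝ) → Prop}
    (h : ∀ᶠ x in 𝓝 (fun _ => t), p x) :
    ∀ᶠ s in 𝓝[>] (0 : ℝ), ∀ᶠ x in 𝓝 (genericCurve I t s), p x := by
  have hc : Continuous (genericCurve I t) := by
    refine continuous_pi fun i => ?_
    unfold genericCurve
    split_ifs <;> fun_prop
  have h0 : genericCurve I t 0 = fun _ => t := by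
    funext i
    simp [genericCurve]
  have h1 : Tendsto (genericCurve I t) (𝓝 0) (𝓝 (fun _ => t)) := h0 ▸ hc.tendsto 0
  exact nhdsWithin_le_nhds (h1.eventually (eventually_eventually_nhds.2 h))

namespace ReLUNetwork

/-- A network that computes the maximum near a constant vector can be restricted to a set of
coordinates on which its first hidden layer is generically affine; this removes the layer. -/
theorem exists_restrict {n m : ℕ} (W : Matrix (Fin m) (Fin n) ℝ) (b : Fin m → ℝ)
    (N : ReLUNetwork m) (t : ℝ)
    (hN : ∀ᶠ x in 𝓝 (fun _ => t), (hidden W b N).eval x = maxCoord x)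
    (I : Finset (Fin n)) (hI : 0 < I.card)
    (hW : ∀ j, (∀ i ∉ I, W j i = 0) → ∀ a c, W j a ≠ 0 → W j c ≠ 0 → a = c) :
    ∃ N' : ReLUNetwork I.card, N'.depth = N.depth ∧ N'.width = N.width ∧
      ∃ t', ∀ᶠ y in 𝓝 (fun _ => t'), N'.eval y = maxCoord y := by
  have hgen : ∀ᶠ s in 𝓝[>] (0 : ℝ), ∀ j, (W j = 0 ∧ b j = 0) ∨
      (∑ i, W j i * genericCurve I t s i) + b j ≠ 0 := by
    rw [eventually_all]
    intro j
    rcases affine_genericCurve_ne_zero I t (W j) (b j) (hW j) with h | h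
    · exact Eventually.of_forall fun s => Or.inl h
    · exact h.mono fun s hs => Or.inr hs
  obtain ⟨s, ⟨hs1, hs2⟩, hs0⟩ :=
    ((hgen.and (eventually_genericCurve I t hN)).and self_mem_nhdsWithin).exists
  have hs0 : 0 < s := hs0
  set p := genericCurve I t s with hp
  have hrelu : ∀ j, ∃ a : ℝ, ∀ᶠ x in 𝓝 p,
      max 0 ((∑ i, W j i * x i) + b j) = a * ((∑ i, W j i * x i) + b j) := by
    intro j
    refine eventually_max_zero_eq (g := fun x : Fin n → ℝ => (∑ i, W j i * x i) + b j)
      (by fun_prop) ?_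
    rcases hs1 j with h | h
    · left
      intro x
      simp [h.1, h.2]
    · exact Or.inr h
  choose a ha using hrelu
  let e : Fin I.card ≃ I := I.equivFin.symm
  let ext : (Fin I.card → ℝ) → Fin n → ℝ := fun y i =>
    if h : i ∈ I then y (e.symm ⟨i, h⟩) else p i
  have hext : Continuous ext := by
    refine continuous_pi fun i => ?_
    by_cases h : i ∈ I
    · simp only [ext, h, dite_true]
      fun_prop
    · simp only [ext, h, dite_false]
      fun_prop
  have hext0 : ext (fun _ => t + s) = p := by
    funext i
    by_cases h : i ∈ I <;> simp [ext, h, hp, genericCurve]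
  have htend : Tendsto ext (𝓝 fun _ => t + s) (𝓝 p) := hext0 ▸ hext.tendsto _
  have hsum : ∀ (w : Fin n → ℝ) (y : Fin I.card → ℝ),
      ∑ i, w i * ext y i = (∑ k, w (e k) * y k) + ∑ i ∈ Iᶜ, w i * p i := by
    intro w y
    rw [← Finset.sum_add_sum_compl I]
    congr 1
    · rw [← Finset.sum_coe_sort I (fun i => w i * ext y i), ← e.sum_comp]
      refine Finset.sum_congr rfl fun k _ => ?_
      simp [ext]
    · refine Finset.sum_congr rfl fun i hi => ?_
      simp [ext, Finset.mem_compl.1 hi]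
  obtain ⟨N', hd, hw, hN'⟩ := N.exists_eval_affine (n := I.card)
    (fun j k => a j * W j (e k)) (fun j => a j * ((∑ i ∈ Iᶜ, W j i * p i) + b j))
  refine ⟨N', hd, hw, t + s, ?_⟩
  -- The frozen coordinates lie below `t`, so they never attain the maximum.
  have hmax : ∀ᶠ y in 𝓝 (fun _ : Fin I.card => t + s), ∀ k, t < y k := by
    rw [eventually_all]
    intro k
    exact (continuous_apply k).continuousAt.eventually_const_lt (by simpa using hs0)
  filter_upwards [htend.eventually (hs2.and (eventually_all.2 ha)), hmax] with y hy hty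
  obtain ⟨hy1, hy2⟩ := hy
  rw [hN']
  have h1 : maxCoord (ext y) = maxCoord y := by
    obtain ⟨⟨k, hk⟩, hle⟩ := isGreatest_maxCoord hI y
    refine maxCoord_eq (e k) (by simp [ext, hk]) fun i => ?_
    by_cases h : i ∈ I
    · simp only [ext, h, dite_true]
      exact hle ⟨_, rfl⟩
    · simp only [ext, h, dite_false, hp, genericCurve, if_false]
      have := hty k
      have := pow_pos hs0 (i.val + 2)
      linarith
  rw [← h1, ← hy1, eval]
  congr 1
  funext j
  rw [hy2 j, hsum]
  simp only [mul_add, Finset.mul_sum]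
  simp only [mul_assoc, add_assoc]

end ReLUNetwork

/-! ### Base case: one hidden layer -/

theorem eventually_relu_second_difference (a u : ℝ) :
    ∀ᶠ δ in 𝓝[>] (0 : ℝ), max 0 (a + δ * u) + max 0 (a + -δ * u) - 2 * max 0 a =
      if a = 0 then δ * |u| else 0 := by
  rcases lt_trichotomy a 0 with h | h | h
  · have h1 : ∀ᶠ δ in 𝓝 (0 : ℝ), a + δ * u < 0 :=
      (by fun_prop : Continuous fun δ : ℝ => a + δ * u).continuousAt.eventually_lt_const (by simpa)
    have h2 : ∀ᶠ δ in 𝓝 (0 : ℝ), a + -δ * u < 0 :=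
      (by fun_prop : Continuous fun δ : ℝ => a + -δ * u).continuousAt.eventually_lt_const (by simpa)
    filter_upwards [nhdsWithin_le_nhds h1, nhdsWithin_le_nhds h2] with δ h1 h2
    rw [max_eq_left h1.le, max_eq_left h2.le, max_eq_left h.le, if_neg h.ne]
    ring
  · filter_upwards [self_mem_nhdsWithin] with δ hδ
    have hδ : 0 < δ := hδ
    rcases le_total 0 u with hu | hu
    · rw [h, abs_of_nonneg hu, max_eq_right (by nlinarith), max_eq_left (by nlinarith)]
      simp
    · rw [h, abs_of_nonpos hu, max_eq_left (by nlinarith), max_eq_right (by nlinarith)]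
      simp
  · have h1 : ∀ᶠ δ in 𝓝 (0 : ℝ), 0 < a + δ * u :=
      (by fun_prop : Continuous fun δ : ℝ => a + δ * u).continuousAt.eventually_const_lt (by simpa)
    have h2 : ∀ᶠ δ in 𝓝 (0 : ℝ), 0 < a + -δ * u :=
      (by fun_prop : Continuous fun δ : ℝ => a + -δ * u).continuousAt.eventually_const_lt (by simpa)
    filter_upwards [nhdsWithin_le_nhds h1, nhdsWithin_le_nhds h2] with δ h1 h2
    rw [max_eq_right h1.le, max_eq_right h2.le, max_eq_right h.le, if_neg h.ne']
    ring

/-- For small `s`, a kink met at `s` must have `α = β = 0`, hence is also met at `-s`. -/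
theorem eventually_affine_eq_zero_iff (α β : ℝ) :
    ∀ᶠ s in 𝓝[>] (0 : ℝ), (α + s * β = 0 ↔ α + -s * β = 0) := by
  by_cases hα : α = 0
  · refine Eventually.of_forall fun s => ?_
    simp [hα]
  · have h1 : ∀ᶠ s in 𝓝 (0 : ℝ), α + s * β ≠ 0 :=
      (by fun_prop : Continuous fun s : ℝ => α + s * β).continuousAt.eventually_ne (by simpa)
    have h2 : ∀ᶠ s in 𝓝 (0 : ℝ), α + -s * β ≠ 0 :=
      (by fun_prop : Continuous fun s : ℝ => α + -s * β).continuousAt.eventually_ne (by simpa)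
    filter_upwards [nhdsWithin_le_nhds h1, nhdsWithin_le_nhds h2] with s h1 h2
    exact iff_of_false h1 h2

/-- The point `t + s e₂ + δ (e₀ - e₁)`, near the ridge `x₀ = x₁`. -/
noncomputable def ridgePoint {n : ℕ} (i₀ i₁ i₂ : Fin n) (t s δ : ℝ) (i : Fin n) : ℝ :=
  t + s * (if i = i₂ then 1 else 0) + δ * ((if i = i₀ then 1 else 0) - if i = i₁ then 1 else 0)

namespace ReLUNetwork

/-- One hidden layer does not suffice for the maximum of three numbers, not even locally. -/
theorem not_eventually_eval_eq_maxCoord {n m : ℕ} (hn : 3 ≤ n) (W : Matrix (Fin m) (Fin n) ℝ)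
    (b : Fin m → ℝ) (v : Fin m → ℝ) (c t : ℝ) :
    ¬ ∀ᶠ x in 𝓝 (fun _ => t), (hidden W b (output v c)).eval x = maxCoord x := by
  intro hN
  let i₀ : Fin n := ⟨0, by omega⟩
  let i₁ : Fin n := ⟨1, by omega⟩
  let i₂ : Fin n := ⟨2, by omega⟩
  have h01 : i₀ ≠ i₁ := by simp [i₀, i₁]
  have h02 : i₀ ≠ i₂ := by simp [i₀, i₂]
  have h12 : i₁ ≠ i₂ := by simp [i₁, i₂]
  let r := ridgePoint i₀ i₁ i₂ t
  have hr2 : Continuous fun z : ℝ × ℝ => r z.1 z.2 := by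
    refine continuous_pi fun i => ?_
    simp only [r, ridgePoint]
    fun_prop
  have hr0 : r 0 0 = fun _ => t := by
    funext i
    simp [r, ridgePoint]
  let f := (hidden W b (output v c)).eval
  have hlin : ∀ j s δ, (∑ i, W j i * r s δ i) + b j =
      ((∑ i, W j i * t) + b j + s * W j i₂) + δ * (W j i₀ - W j i₁) := by
    intro j s δ
    simp only [r, ridgePoint, mul_add, mul_sub, Finset.sum_add_distrib, Finset.sum_sub_distrib]
    simp only [mul_ite, mul_one, mul_zero, Finset.sum_ite_eq', Finset.mem_univ, if_true]
    ring
  have hdiff : ∀ s, ∀ᶠ δ in 𝓝[>] (0 : ℝ), f (r s δ) + f (r s (-δ)) - 2 * f (r s 0) =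
      ∑ j, v j * if (∑ i, W j i * t) + b j + s * W j i₂ = 0 then δ * |W j i₀ - W j i₁| else 0 := by
    intro s
    have h := eventually_all.2 fun j =>
      eventually_relu_second_difference ((∑ i, W j i * t) + b j + s * W j i₂) (W j i₀ - W j i₁)
    filter_upwards [h] with δ hδ
    simp only [← hδ, f, eval, hlin, mul_sub, mul_add, Finset.sum_add_distrib,
      Finset.sum_sub_distrib, Finset.mul_sum]
    simp only [zero_mul, add_zero, sub_self, mul_left_comm (2 : ℝ)]
    ring
  have hmax : ∀ᶠ s in 𝓝 (0 : ℝ), ∀ᶠ δ in 𝓝 (0 : ℝ), f (r s δ) = maxCoord (r s δ) := by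
    have h1 : ∀ᶠ z in 𝓝 ((0 : ℝ), (0 : ℝ)), f (r z.1 z.2) = maxCoord (r z.1 z.2) := by
      have : Tendsto (fun z : ℝ × ℝ => r z.1 z.2) (𝓝 (0, 0)) (𝓝 fun _ => t) :=
        hr0 ▸ hr2.tendsto (0, 0)
      exact this.eventually hN
    rw [nhds_prod_eq] at h1
    exact h1.curry
  have hneg : Tendsto (fun s : ℝ => -s) (𝓝 0) (𝓝 0) := by
    simpa using (continuous_neg (G := ℝ)).tendsto 0
  have hiff := eventually_all.2 fun j =>
    eventually_affine_eq_zero_iff ((∑ i, W j i * t) + b j) (W j i₂)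
  obtain ⟨s, ⟨hiff, hsp, hsn⟩, hs⟩ := ((hiff.and (nhdsWithin_le_nhds (hmax.and
    (hneg.eventually hmax)))).and (self_mem_nhdsWithin (s := Set.Ioi (0 : ℝ)))).exists
  have hs : 0 < s := hs
  have hsmall : ∀ᶠ δ in 𝓝 (0 : ℝ), δ < s := eventually_lt_nhds hs
  obtain ⟨δ, ⟨⟨⟨⟨⟨⟨hdp, hdn⟩, h1⟩, h2⟩, h3⟩, h4⟩, hδs⟩, hδ⟩ :=
    ((((((((hdiff s).and (hdiff (-s))).and (nhdsWithin_le_nhds hsp)).and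
      (nhdsWithin_le_nhds (hneg.eventually hsp))).and (nhdsWithin_le_nhds hsn)).and
      (nhdsWithin_le_nhds (hneg.eventually hsn))).and (nhdsWithin_le_nhds hsmall)).and
      (self_mem_nhdsWithin (s := Set.Ioi (0 : ℝ)))).exists
  have hδ : 0 < δ := hδ
  have h5 := hsp.self_of_nhds
  have h6 := hsn.self_of_nhds
  -- The network's second difference across `x₀ = x₁` is the same at `s` and `-s`. For the maximum
  -- it is 0 at `s`, where `x₂` dominates, but `2δ` at `-s`.
  have heq : f (r s δ) + f (r s (-δ)) - 2 * f (r s 0) =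
      f (r (-s) δ) + f (r (-s) (-δ)) - 2 * f (r (-s) 0) := by
    rw [hdp, hdn]
    refine Finset.sum_congr rfl fun j _ => ?_
    simp only [hiff j]
  rw [h1, h2, h3, h4, h5, h6] at heq
  have hval : ∀ s δ : ℝ, ∀ i, r s δ i = if i = i₂ then t + s else if i = i₀ then t + δ else
      if i = i₁ then t - δ else t := by
    intro s δ i
    simp only [r, ridgePoint]
    split_ifs <;> simp_all [sub_eq_add_neg]
  have m1 : maxCoord (r s δ) = t + s := maxCoord_eq i₂ (by simp [hval]) fun i => by
    rw [hval]; split_ifs <;> linarith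
  have m2 : maxCoord (r s (-δ)) = t + s := maxCoord_eq i₂ (by simp [hval]) fun i => by
    rw [hval]; split_ifs <;> linarith
  have m3 : maxCoord (r s 0) = t + s := maxCoord_eq i₂ (by simp [hval]) fun i => by
    rw [hval]; split_ifs <;> linarith
  have m4 : maxCoord (r (-s) δ) = t + δ := maxCoord_eq i₀ (by simp [hval, h02]) fun i => by
    rw [hval]; split_ifs <;> linarith
  have m5 : maxCoord (r (-s) (-δ)) = t + δ :=
    maxCoord_eq i₁ (by simp [hval, h12, h01.symm]) fun i => by
      rw [hval]; split_ifs <;> linarith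
  have m6 : maxCoord (r (-s) 0) = t := maxCoord_eq i₀ (by simp [hval, h02]) fun i => by
    rw [hval]; split_ifs <;> linarith
  rw [m1, m2, m3, m4, m5, m6] at heq
  linarith

/-! ### Iteration and the width bound -/

/-- Since `D` only shrinks, one `A` serves all layers, and Turán becomes `(D/A)² ≤ |I|/A`. -/
theorem mul_div_pow_le_two (A w : ℝ) (hw : 0 ≤ w) (j : ℕ) :
    ∀ {D : ℕ} (N : ReLUNetwork D), N.depth = j + 2 → (N.width : ℝ) ≤ w → 2 * w + D ≤ A →
      (∃ t, ∀ᶠ x in 𝓝 (fun _ => t), N.eval x = maxCoord x) → A * (D / A) ^ 2 ^ j ≤ 2 := by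
  induction j with
  | zero =>
    intro D N hd _ hA ⟨t, ht⟩
    have hD : D ≤ 2 := by
      by_contra hlt
      cases N with
      | output => simp [depth] at hd
      | hidden W b N =>
        cases N with
        | output v c => exact not_eventually_eval_eq_maxCoord (by omega) W b v c t ht
        | hidden W' b' N =>
          cases N <;> simp [depth] at hd
    have hD' : (D : ℝ) ≤ 2 := by exact_mod_cast hD
    by_cases hA0 : A = 0
    · simp [hA0]
    · simpa [mul_div_cancel₀, hA0] using hD'
  | succ j ih =>
    intro D N hd hwd hA ⟨t, ht⟩
    rcases Nat.eq_zero_or_pos D with rfl | hD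
    · simp
    cases N with
    | output => simp [depth] at hd
    | @hidden _ m W b N =>
      obtain ⟨I, hI, hW⟩ := exists_finset_support_subsingleton W
      have hIpos : 0 < I.card := by
        rcases Nat.eq_zero_or_pos I.card with h | h
        · rw [h, mul_zero] at hI
          have := pow_pos hD 2
          omega
        · exact h
      obtain ⟨N', hd', hw', t', ht'⟩ := exists_restrict W b N t ht I hIpos hW
      simp only [width, Nat.cast_max, max_le_iff] at hwd
      have hID : (I.card : ℝ) ≤ D := by
        exact_mod_cast (Finset.card_le_univ I).trans (by simp)
      have hDR : (0 : ℝ) < D := by exact_mod_cast hD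
      have hApos : 0 < A := by linarith
      have hle := ih N' (by simp only [depth] at hd; omega) (by rw [hw']; exact hwd.2)
        (by linarith) ⟨t', ht'⟩
      refine le_trans ?_ hle
      rw [pow_succ' 2 j, pow_mul]
      have hI' : (D : ℝ) ^ 2 ≤ (2 * m + D) * I.card := by exact_mod_cast hI
      have hI'' : (D : ℝ) ^ 2 ≤ A * I.card :=
        hI'.trans (mul_le_mul_of_nonneg_right (by linarith [hwd.1]) (Nat.cast_nonneg _))
      gcongr
      rw [div_pow, div_le_div_iff₀ (by positivity) hApos]
      nlinarith

end ReLUNetwork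

theorem two_pow_two_pow_le {d k : ℕ} (hk : 3 ≤ k)
    (hkd : (k : ℝ) ≤ Real.logb 2 (Real.logb 2 (d : ℝ))) : (2 : ℝ) ^ 2 ^ k ≤ d := by
  have hk' : (3 : ℝ) ≤ k := by exact_mod_cast hk
  have hd : 2 ≤ d := by
    by_contra h
    have : d = 0 ∨ d = 1 := by omega
    -- Here both logarithms take the value 0, contradicting `3 ≤ k`.
    rcases this with rfl | rfl <;> simp at hkd <;> omega
  have hd' : (2 : ℝ) ≤ d := by exact_mod_cast hd
  have hpos : 0 < Real.logb 2 (d : ℝ) := Real.logb_pos (by norm_num) (by linarith)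
  rw [Real.le_logb_iff_rpow_le (by norm_num) hpos,
    Real.le_logb_iff_rpow_le (by norm_num) (by linarith)] at hkd
  exact_mod_cast hkd

theorem theorem1 (d k : ℕ) (hk : 3 ≤ k)
    (hkd : (k : ℝ) ≤ Real.logb 2 (Real.logb 2 (d : ℝ)))
    (N : ReLUNetwork d) (hdepth : N.depth = k)
    (hN : ∀ x : Fin d → ℝ, (∀ i, x i ∈ Set.Icc (0 : ℝ) 1) → N.eval x = maxCoord x) :
    (0.1 : ℝ) * (d : ℝ) ^ ((1 : ℝ) + 1 / ((2 : ℝ) ^ (k - 2) - 1)) ≤ (N.width : ℝ) := by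
  by_contra! hlt
  have hdk := two_pow_two_pow_le hk hkd
  have hd0 : (0 : ℝ) < d := lt_of_lt_of_le (by positivity) hdk
  obtain ⟨j, rfl⟩ : ∃ j, k = j + 3 := ⟨k - 3, by omega⟩
  rw [show j + 3 - 2 = j + 1 by omega] at hlt
  obtain ⟨n, hn⟩ : ∃ n, 2 ^ (j + 1) = n + 1 := ⟨2 ^ (j + 1) - 1, by
    have := Nat.one_le_two_pow (n := j + 1); omega⟩
  have hn1 : 1 ≤ n := by
    have : 2 ^ 1 ≤ 2 ^ (j + 1) := Nat.pow_le_pow_right (by norm_num) (by omega)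
    omega
  have hnR : (2 : ℝ) ^ (j + 1) - 1 = n := by
    have : (2 : ℝ) ^ (j + 1) = n + 1 := by exact_mod_cast hn
    linarith
  rw [hnR, Real.rpow_add hd0, Real.rpow_one] at hlt
  set ρ : ℝ := (d : ℝ) ^ (1 / (n : ℝ)) with hρ
  have hρn : ρ ^ n = d := by
    rw [hρ, one_div, Real.rpow_inv_natCast_pow hd0.le (by omega)]
  have hρ0 : 0 < ρ := Real.rpow_pos_of_pos hd0 _
  -- As `2 ^ k = 4 * (n + 1)`, one has `16 ^ n ≤ 2 ^ 2 ^ k ≤ d = ρ ^ n`.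
  have hρ16 : 16 ≤ ρ := by
    refine le_of_pow_le_pow_left₀ (n := n) (by omega) hρ0.le ?_
    rw [hρn]
    refine le_trans ?_ hdk
    rw [show (16 : ℝ) = 2 ^ 4 by norm_num, ← pow_mul]
    refine pow_le_pow_right₀ (by norm_num) ?_
    have : 2 ^ (j + 3) = 4 * 2 ^ (j + 1) := by ring
    omega
  have hnear : ∀ᶠ x in 𝓝 (fun _ : Fin d => (1 / 2 : ℝ)), N.eval x = maxCoord x := by
    have h1 : ∀ᶠ x in 𝓝 (fun _ : Fin d => (1 / 2 : ℝ)), ∀ i, x i ∈ Set.Icc (0 : ℝ) 1 := by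
      rw [eventually_all]
      intro i
      exact (continuous_apply i).continuousAt.eventually
        (Icc_mem_nhds (by norm_num) (by norm_num))
    exact h1.mono hN
  -- The factor 0.3 works because `2 * 0.1 + 1 / 16 < 0.3`; the left side then equals `(10/3) ^ n >
  -- 2`.
  have hle := ReLUNetwork.mul_div_pow_le_two (0.3 * (d * ρ)) N.width (Nat.cast_nonneg _) (j + 1) N
    hdepth le_rfl (by nlinarith) ⟨_, hnear⟩
  have hratio : (d : ℝ) / (0.3 * (d * ρ)) = (10 / 3) / ρ := by
    field_simp
    norm_num
  rw [hn, hratio, div_pow, pow_succ ρ, hρn, pow_succ] at hle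
  have hsimp : 0.3 * (d * ρ) * ((10 / 3 : ℝ) ^ n * (10 / 3) / (d * ρ)) = (10 / 3) ^ n := by
    field_simp
    norm_num
  rw [hsimp] at hle
  have : (10 / 3 : ℝ) ^ 1 ≤ (10 / 3) ^ n := pow_le_pow_right₀ (by norm_num) hn1
  norm_num at this
  linarith
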